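/- For an integer $n\ge 0$ let $$G_n(x,z)=\sum_{k=0}^{\lfloor n/2\rfloor}(-1)^k\,\frac{\prod_{i=0}^{n-k-1}(z+i)}{k!\,(n-2k)!}\,(2x)^{n-2k}$$ be the Gegenbauer (ultraspherical) polynomial with parameter $z$, regarded as a polynomial in the two variables $x$ and $z$. Two nonzero real polynomials $p$ and $q$ in one variable, where $\deg p=d$ and $\deg q\in\{d,d-1\}$, are said to interlace if all their roots are real and, writing the roots with multiplicity in non-increasing order as $p_1\ge p_2\ge\dots\ge p_d$ and $q_1\ge q_2\ge\cdots$, one has $$p_1\ge q_1\ge p_2\ge q_2\ge\dots\ge p_{d-1}\ge q_{d-1}\ge p_d\ (\ge q_d),$$ the last inequality being present only if $\deg q=d$; or if, in the case $\deg q=\deg p$, the same chain holds with the roles of $p$ and $q$ exchanged. Theorem (Dual Gegenbauer interlacing). Let $n\ge 1$. For every $x\in[-1,0)\cup(0,1]$, as polynomials in $z$, $G_n(x,z)$ and $G_{n-1}(x,z)$ interlace, and $G_n(x,z)$ and $\partial_xG_n(x,z)$ interlace. At $x=0$, at least one of $G_n(0,z)$ and $G_{n-1}(0,z)$ is identically zero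 in $z$, and at least one of $G_n(0,z)$ and $\partial_xG_n(0,z)$ is identically zero in $z$. -/

import Mathlib

open Polynomial

/-- The Gegenbauer polynomial `G_n(x, z)` as a bivariate polynomial. The outer variable is `x`, the
coefficients are polynomials in the parameter `z`:
`G_n(x,z) = ∑_{k ≤ n/2} (-1)^k (z (z+1) ⋯ (z+n-k-1)) / (k! (n-2k)!) (2x)^(n-2k)`. -/
noncomputable def gegenbauer (n : ℕ) : ℝ[X][X] :=
  ∑ k ∈ Finset.range (n / 2 + 1),
    C (C ((-1 : ℝ) ^ k / ((k.factorial : ℝ) * ((n - 2 * k).factorial : ℝ))) *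
        ∏ i ∈ Finset.range (n - k), (X + C (i : ℝ))) * (2 * X) ^ (n - 2 * k)

/-- `G_n(x, z)` for a fixed real number `x`, as a polynomial in `z`. -/
noncomputable def gegenbauerAt (n : ℕ) (x : ℝ) : ℝ[X] :=
  (gegenbauer n).eval (C x)

/-- `∂_x G_n(x, z)` for a fixed real number `x`, as a polynomial in `z`. -/
noncomputable def gegenbauerDerivAt (n : ℕ) (x : ℝ) : ℝ[X] :=
  (derivative (gegenbauer n)).eval (C x)

/-- `p` is a real polynomial of degree exactly `n`, all of whose roots are real; they are
`a 0 ≥ a 1 ≥ ⋯ ≥ a (n-1)`, listed with multiplicity. -/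
def HasOrderedRealRoots (p : ℝ[X]) (n : ℕ) (a : Fin n → ℝ) : Prop :=
  p ≠ 0 ∧ p.natDegree = n ∧ Antitone a ∧ p.roots = Finset.univ.val.map a

/-- The chain of inequalities `a 0 ≥ b 0 ≥ a 1 ≥ b 1 ≥ ⋯`. -/
def InterlacingChain {n m : ℕ} (a : Fin n → ℝ) (b : Fin m → ℝ) : Prop :=
  (∀ (i : Fin n) (j : Fin m), (i : ℕ) = (j : ℕ) → b j ≤ a i) ∧
    ∀ (j : Fin m) (i : Fin n), (j : ℕ) + 1 = (i : ℕ) → a i ≤ b j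

/-- Two real-rooted polynomials interlace: `p` has degree `n`, `q` has degree `n` or `n - 1`, and the
roots alternate, starting with the largest root of `p`; or, if the degrees agree, starting with
the largest root of `q`. -/
def Interlaces (p q : ℝ[X]) : Prop :=
  ∃ (n m : ℕ) (a : Fin n → ℝ) (b : Fin m → ℝ),
    HasOrderedRealRoots p n a ∧ HasOrderedRealRoots q m b ∧
      (((m = n ∨ m + 1 = n) ∧ InterlacingChain a b) ∨ (m = n ∧ InterlacingChain b a))

/-! By parity in `x`, it suffices to take `0 < x ≤ 1`. Every `G_n` carries a rising factorial in
`z`: `G_{2m} = (z)_m e_m` and `G_{2m+1} = (z)_{m+1} o_m`, with cofactors of degree `m`. For `0 < x <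
1` the roots of consecutive cofactors are located by induction on two relations.

The first, `eval_gegenbauerAt_add_two`, shows that one unit to the left of a root of the current
cofactor, the next cofactor has the sign opposite to that of the previous cofactor at that root. The
resulting sign changes give all the roots of the next cofactor, separated by the shifted roots. The
second, `eval_gegenbauerAt_succ`, shows that at a root of the next cofactor the current one has the
same sign at `z` and at `z + 1`; this raises each bound `b - 1 < a'` to `b < a'`
(`IsRootSeq.lt_of_shift`). So consecutive cofactors interlace, also after a unit shift of one of
them.

The shifted version is the claim on `∂_x G_n = 2 z G_{n-1}(z+1)`. Common rising factorials do not
disturb interlacing, and one leftover integer root lies below all the cofactor roots it is compared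
with. At `x = 1` the roots are explicit; at `x = 0` every odd-index `G_n` vanishes. -/

/-! ### Simple real roots located by sign changes -/

/-- `p` has positive leading coefficient and `d` simple real roots `a 0 > a 1 > ⋯ > a (d - 1)`. -/
def IsRootSeq (p : ℝ[X]) (d : ℕ) (a : ℕ → ℝ) : Prop :=
  (∀ i j, i < j → j < d → a j < a i) ∧
    ∃ c : ℝ, 0 < c ∧ p = C c * ∏ i ∈ Finset.range d, (X - C (a i))

/-- The sign of `p` at a point with exactly `k` roots to its right. -/
theorem IsRootSeq.sign {p : ℝ[X]} {d : ℕ} {a : ℕ → ℝ} (h : IsRootSeq p d a) {k : ℕ} (hk : k ≤ d)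
    {t : ℝ} (h1 : ∀ i < k, t < a i) (h2 : ∀ i, k ≤ i → i < d → a i < t) :
    0 < (-1) ^ k * p.eval t := by
  obtain ⟨-, c, hc, rfl⟩ := h
  rw [eval_mul, eval_C, eval_prod, ← Finset.prod_range_mul_prod_Ico _ hk]
  have e1 : (-1 : ℝ) ^ k * ∏ i ∈ Finset.range k, eval t (X - C (a i))
      = ∏ i ∈ Finset.range k, (a i - t) := by
    have : ((-1 : ℝ)) ^ k = ∏ _i ∈ Finset.range k, (-1 : ℝ) := by simp
    rw [this, ← Finset.prod_mul_distrib]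
    exact Finset.prod_congr rfl fun i _ => by simp
  have e2 : 0 < ∏ i ∈ Finset.range k, (a i - t) :=
    Finset.prod_pos fun i hi => sub_pos.2 (h1 i (Finset.mem_range.1 hi))
  have e3 : 0 < ∏ i ∈ Finset.Ico k d, eval t (X - C (a i)) := by
    refine Finset.prod_pos fun i hi => ?_
    rw [Finset.mem_Ico] at hi
    simpa using h2 i hi.1 hi.2
  calc 0 < c * ((∏ i ∈ Finset.range k, (a i - t)) *
        ∏ i ∈ Finset.Ico k d, eval t (X - C (a i))) := by positivity
    _ = _ := by rw [← e1]; ring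

theorem IsRootSeq.eval_eq_zero {p : ℝ[X]} {d : ℕ} {a : ℕ → ℝ} (h : IsRootSeq p d a) {i : ℕ}
    (hi : i < d) : p.eval (a i) = 0 := by
  obtain ⟨-, c, hc, rfl⟩ := h
  rw [eval_mul, eval_prod, Finset.prod_eq_zero (Finset.mem_range.2 hi) (by simp), mul_zero]

/-- A polynomial of degree `d` changing sign between consecutive separators `s 0 > ⋯ > s d` has
exactly one root in each gap. -/
theorem exists_isRootSeq_of_sign {p : ℝ[X]} {d : ℕ} (hd : p.natDegree = d)
    (hl : 0 < p.leadingCoeff) {s : ℕ → ℝ} (hs : ∀ i < d, s (i + 1) < s i)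
    (h : ∀ i ≤ d, 0 < (-1) ^ i * p.eval (s i)) :
    ∃ a, IsRootSeq p d a ∧ ∀ i < d, s (i + 1) < a i ∧ a i < s i := by
  have key : ∀ i, ∃ r, i < d → (s (i + 1) < r ∧ r < s i) ∧ p.eval r = 0 := by
    intro i
    by_cases hi : i < d
    · have hc : ContinuousOn (fun t => (-1) ^ i * p.eval t) (Set.Icc (s (i + 1)) (s i)) :=
        (continuous_const.mul p.continuous).continuousOn
      have h0 := h i hi.le
      have h1 := h (i + 1) hi
      have h2 : (0 : ℝ) ∈ Set.Ioo ((-1) ^ i * p.eval (s (i + 1))) ((-1) ^ i * p.eval (s i)) := by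
        refine ⟨?_, h0⟩
        rw [pow_succ] at h1
        linarith
      obtain ⟨r, hr, hr0⟩ := intermediate_value_Ioo (hs i hi).le hc h2
      refine ⟨r, fun _ => ⟨hr, ?_⟩⟩
      simpa using hr0
    · exact ⟨0, fun h => absurd h hi⟩
  choose a ha using key
  have hanti : ∀ i j, i < j → j < d → a j < a i := by
    intro i j hij
    induction j, hij using Nat.le_induction with
    | base => exact fun hj => (ha _ hj).1.2.trans (ha i (by omega)).1.1
    | succ j hj ih =>
      exact fun hj' => ((ha _ hj').1.2.trans (ha j (by omega)).1.1).trans (ih (by omega))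
  refine ⟨a, ⟨hanti, p.leadingCoeff, hl, ?_⟩, fun i hi => (ha i hi).1⟩
  have hp : p ≠ 0 := leadingCoeff_ne_zero.1 hl.ne'
  have hinj : Set.InjOn a (Finset.range d : Set ℕ) := by
    intro i hi j hj hij
    simp only [Finset.coe_range, Set.mem_Iio] at hi hj
    rcases lt_trichotomy i j with h | h | h
    · exact absurd hij (hanti i j h hj).ne'
    · exact h
    · exact absurd hij (hanti j i h hi).ne
  -- The `d` distinct roots found exhaust a polynomial of degree `d`.
  have hle : (Finset.range d).val.map a ≤ p.roots := by
    rw [Multiset.le_iff_subset (Multiset.Nodup.map_on (fun i hi j hj hij => hinj hi hj hij)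
      (Finset.range d).nodup)]
    intro r hr
    obtain ⟨i, hi, rfl⟩ := Multiset.mem_map.1 hr
    exact (mem_roots hp).2 (ha i (Finset.mem_range.1 hi)).2
  have heq : (Finset.range d).val.map a = p.roots :=
    Multiset.eq_of_le_of_card_le hle (by simpa [hd] using p.card_roots')
  have := C_leadingCoeff_mul_prod_multiset_X_sub_C (p := p) (by rw [← heq]; simp [hd])
  rw [← heq, Multiset.map_map] at this
  exact this.symm

theorem exists_gt_eval_pos {p : ℝ[X]} (hl : 0 < p.leadingCoeff) (t : ℝ) :
    ∃ s, t < s ∧ 0 < p.eval s := by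
  rcases Nat.eq_zero_or_pos p.natDegree with h0 | h0
  · rw [eq_C_of_natDegree_eq_zero h0] at hl ⊢
    exact ⟨t + 1, by linarith, by simpa using hl⟩
  · have := p.tendsto_atTop_of_leadingCoeff_nonneg (natDegree_pos_iff_degree_pos.1 h0) hl.le
    exact ((Filter.eventually_gt_atTop t).and (this.eventually_gt_atTop 0)).exists

/-- If `f` alternates in sign at `s 0 > s 1 > ⋯ > s (d - 1)`, starting with a negative sign, and has
degree `d`, then it has a root above `s 0` and one in each gap. -/
theorem exists_isRootSeq_of_sign_top {f : ℝ[X]} {d : ℕ} (hd : f.natDegree = d)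
    (hl : 0 < f.leadingCoeff) {s : ℕ → ℝ} (hs : ∀ i, i + 1 < d → s (i + 1) < s i)
    (h : ∀ i < d, 0 < (-1) ^ (i + 1) * f.eval (s i)) :
    ∃ a, IsRootSeq f d a ∧ (∀ i < d, s i < a i) ∧ ∀ i, i + 1 < d → a (i + 1) < s i := by
  obtain ⟨M, hM, hfM⟩ := exists_gt_eval_pos hl (s 0)
  -- The point `M`, where `f` is positive, is prepended to the separators, so their indices move up
  -- by one.
  obtain ⟨a, ha, hsep⟩ := exists_isRootSeq_of_sign (s := fun i => Nat.casesOn i M s) hd hl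
    (by
      rintro (_ | i) hi
      · exact hM
      · exact hs i hi)
    (by
      rintro (_ | i) hi
      · simpa using hfM
      · exact h i hi)
  exact ⟨a, ha, fun i hi => (hsep i hi).1, fun i hi => (hsep (i + 1) hi).2⟩

/-- Let `a` be the roots of `f`, with gaps greater than `1`, and let `b` satisfy
`b (i + 1) < a i - 1 < b i`. If `f` has the same sign at `b i` and at `b i + 1`, then `a i < b i`. -/
theorem IsRootSeq.lt_of_shift {f : ℝ[X]} {d : ℕ} {a b : ℕ → ℝ} (h : IsRootSeq f d a)
    (hgap : ∀ i, i + 1 < d → a (i + 1) < a i - 1) {i : ℕ} (hi : i < d) (hab : a i - 1 < b i)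
    (hba : ∀ j, j + 1 = i → b i < a j - 1)
    (hpos : ∃ u v : ℝ, 0 < u ∧ 0 < v ∧ u * f.eval (b i) = v * f.eval (b i + 1)) : a i < b i := by
  have hle : ∀ j k, j ≤ k → k < d → a k ≤ a j := fun j k hjk hk => by
    rcases hjk.eq_or_lt with rfl | hlt
    · exact le_rfl
    · exact (h.1 j k hlt hk).le
  have hup : ∀ j < i, b i < a j - 1 := by
    intro j hj
    have h1 := hba (i - 1) (by omega)
    have h2 := hle j (i - 1) (by omega) (by omega)
    linarith
  -- The point `b i + 1` lies between `a i` and `a (i - 1)`.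
  have h1 : 0 < (-1) ^ i * f.eval (b i + 1) := by
    refine h.sign hi.le (fun j hj => by linarith [hup j hj]) fun j hj hjd => ?_
    linarith [hle i j hj hjd]
  obtain ⟨u, v, hu, hv, huv⟩ := hpos
  have h2 : 0 < (-1) ^ i * f.eval (b i) := by
    refine pos_of_mul_pos_right (a := u) ?_ hu.le
    have : u * ((-1) ^ i * f.eval (b i)) = v * ((-1) ^ i * f.eval (b i + 1)) := by
      linear_combination (-1) ^ i * huv
    rw [this]
    positivity
  by_contra! hcon
  rcases hcon.eq_or_lt with he | hlt
  · rw [he, h.eval_eq_zero hi] at h2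
    simp at h2
  -- Here `a i - 1 < b i < a i`; as gaps exceed `1`, moving from `b i + 1` to `b i` crosses the root
  -- `a i` and no other, so the sign flips.
  · have h3 : 0 < (-1) ^ (i + 1) * f.eval (b i) := by
      refine h.sign hi (fun j hj => ?_) fun j hj hjd => ?_
      · rcases (Nat.lt_succ_iff.1 hj).eq_or_lt with rfl | hj
        · exact hlt
        · linarith [hup j hj]
      · linarith [hle (i + 1) j hj hjd, hgap i (by omega)]
    rw [pow_succ] at h3
    linarith

/-! ### Root multisets and interlacing by counting -/

/-- A nonzero multiple of `∏ r ∈ A, (X - r)`. -/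
def HasRootMultiset (p : ℝ[X]) (A : Multiset ℝ) : Prop :=
  ∃ c : ℝ, c ≠ 0 ∧ p = C c * (A.map fun r => X - C r).prod

theorem HasRootMultiset.C_mul {p : ℝ[X]} {A : Multiset ℝ} (h : HasRootMultiset p A) {c : ℝ}
    (hc : c ≠ 0) : HasRootMultiset (C c * p) A := by
  obtain ⟨d, hd, rfl⟩ := h
  exact ⟨c * d, mul_ne_zero hc hd, by rw [Polynomial.C_mul, mul_assoc]⟩

theorem HasRootMultiset.mul {p q : ℝ[X]} {A B : Multiset ℝ} (hp : HasRootMultiset p A)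
    (hq : HasRootMultiset q B) : HasRootMultiset (p * q) (A + B) := by
  obtain ⟨c, hc, rfl⟩ := hp
  obtain ⟨d, hd, rfl⟩ := hq
  refine ⟨c * d, mul_ne_zero hc hd, ?_⟩
  rw [Multiset.map_add, Multiset.prod_add, Polynomial.C_mul]
  ring

theorem IsRootSeq.hasRootMultiset {p : ℝ[X]} {d : ℕ} {a : ℕ → ℝ} (h : IsRootSeq p d a) :
    HasRootMultiset p ((Multiset.range d).map a) := by
  obtain ⟨-, c, hc, rfl⟩ := h
  exact ⟨c, hc.ne', by rw [Multiset.map_map]; rfl⟩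

theorem IsRootSeq.comp_X_add_one {p : ℝ[X]} {d : ℕ} {a : ℕ → ℝ} (h : IsRootSeq p d a) :
    IsRootSeq (p.comp (X + C 1)) d fun i => a i - 1 := by
  obtain ⟨ha, c, hc, rfl⟩ := h
  refine ⟨fun i j hij hj => by linarith [ha i j hij hj], c, hc, ?_⟩
  rw [mul_comp, C_comp, prod_comp]
  congr 1
  refine Finset.prod_congr rfl fun i _ => ?_
  simp only [sub_comp, X_comp, C_comp, C_sub]
  ring

theorem HasRootMultiset.exists_hasOrderedRealRoots {p : ℝ[X]} {A : Multiset ℝ}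
    (h : HasRootMultiset p A) :
    ∃ a : Fin A.card → ℝ, HasOrderedRealRoots p A.card a ∧ A = Finset.univ.val.map a := by
  obtain ⟨c, hc, rfl⟩ := h
  set l := A.sort (· ≥ ·) with hl
  have hlen : l.length = A.card := Multiset.length_sort _
  have hroots : (C c * (A.map fun r => X - C r).prod).roots = A := by
    rw [roots_C_mul _ hc, roots_multiset_prod_X_sub_C]
  have hmap : A = Finset.univ.val.map fun i : Fin A.card => l.get (i.cast hlen.symm) := by
    conv_lhs => rw [← Multiset.sort_eq A (· ≥ ·), ← hl]
    rw [Fin.univ_val_map]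
    congr 1
    apply List.ext_get <;> simp [hlen]
  refine ⟨fun i => l.get (i.cast hlen.symm), ⟨?_, ?_, ?_, hroots.trans hmap⟩, hmap⟩
  · exact mul_ne_zero (C_ne_zero.2 hc)
      (monic_multiset_prod_of_monic _ _ fun r _ => monic_X_sub_C r).ne_zero
  · rw [natDegree_C_mul hc, natDegree_multiset_prod_X_sub_C_eq_card]
  · intro i j hij
    have hs : l.Pairwise (· ≥ ·) := Multiset.pairwise_sort A (· ≥ ·)
    rcases hij.eq_or_lt with rfl | hlt
    · exact le_rfl
    · exact List.pairwise_iff_get.1 hs _ _ hlt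

theorem lt_countP_of_antitone {n : ℕ} {a : Fin n → ℝ} (ha : Antitone a) {t : ℝ} {i : Fin n}
    (h : t < a i) : (i : ℕ) < (Finset.univ.val.map a).countP (t < ·) := by
  rw [Multiset.countP_map]
  calc (i : ℕ) < (Finset.Iic i).card := by simp
    _ ≤ (Finset.univ.filter fun j => t < a j).card :=
      Finset.card_le_card fun j hj => by
        simpa using h.trans_le (ha (Finset.mem_Iic.1 hj))

theorem countP_le_of_antitone {n : ℕ} {a : Fin n → ℝ} (ha : Antitone a) {t : ℝ} {i : Fin n}
    (h : a i ≤ t) : (Finset.univ.val.map a).countP (t < ·) ≤ i := by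
  rw [Multiset.countP_map]
  calc (Finset.univ.filter fun j => t < a j).card ≤ (Finset.Iio i).card :=
      Finset.card_le_card fun j hj => by
        rw [Finset.mem_Iio]
        by_contra! hij
        exact absurd (Finset.mem_filter.1 hj).2 (not_lt.2 ((ha hij).trans h))
    _ = i := by simp

/-- The number of elements of `A` above any `t` is that of `B` or one more. -/
def CountLeads (A B : Multiset ℝ) : Prop :=
  ∀ t : ℝ, B.countP (t < ·) ≤ A.countP (t < ·) ∧ A.countP (t < ·) ≤ B.countP (t < ·) + 1

/-- A violated inequality of the chain contradicts the counts at the threshold `t` equal to the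
smaller of its two roots. -/
theorem interlaces_of_countLeads {p q : ℝ[X]} {A B : Multiset ℝ} (hp : HasRootMultiset p A)
    (hq : HasRootMultiset q B) (hcard : B.card = A.card ∨ B.card + 1 = A.card)
    (h : CountLeads A B) : Interlaces p q := by
  obtain ⟨a, ha, hA⟩ := hp.exists_hasOrderedRealRoots
  obtain ⟨b, hb, hB⟩ := hq.exists_hasOrderedRealRoots
  refine ⟨_, _, a, b, ha, hb, Or.inl ⟨hcard, fun i j hij => ?_, fun j i hij => ?_⟩⟩
  · by_contra! hlt
    have h1 := lt_countP_of_antitone hb.2.2.1 hlt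
    have h2 := countP_le_of_antitone ha.2.2.1 (le_refl (a i))
    rw [← hA] at h2
    rw [← hB] at h1
    have := (h (a i)).1
    omega
  · by_contra! hlt
    have h1 := lt_countP_of_antitone ha.2.2.1 hlt
    have h2 := countP_le_of_antitone hb.2.2.1 (le_refl (b j))
    rw [← hB] at h2
    rw [← hA] at h1
    have := (h (b j)).2
    omega

/-- Common roots add the same number to both counts, so a common factor never requires merging
sorted lists of roots. -/
theorem CountLeads.add_left {A B : Multiset ℝ} (h : CountLeads A B) (S : Multiset ℝ) :
    CountLeads (S + A) (S + B) := by
  intro t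
  simp only [Multiset.countP_add]
  have := h t
  omega

/-- `A` and `B` given by alternating sequences, `A` starting. -/
theorem countLeads_of_chain {n m : ℕ} {a b : ℕ → ℝ} (hmn : m ≤ n) (hnm : n ≤ m + 1)
    (h1 : ∀ i < m, b i ≤ a i) (h2 : ∀ i, i + 1 < n → a (i + 1) ≤ b i) :
    CountLeads ((Multiset.range n).map a) ((Multiset.range m).map b) := by
  intro t
  rw [Multiset.countP_map, Multiset.countP_map]
  change ((Finset.range m).filter fun i => t < b i).card ≤
      ((Finset.range n).filter fun i => t < a i).card ∧
    ((Finset.range n).filter fun i => t < a i).card ≤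
      ((Finset.range m).filter fun i => t < b i).card + 1
  constructor
  · refine Finset.card_le_card fun i hi => ?_
    rw [Finset.mem_filter, Finset.mem_range] at hi ⊢
    exact ⟨by omega, hi.2.trans_le (h1 i hi.1)⟩
  -- If `a (i + 1)` exceeds `t`, so does `b i`; only the index `0` has no such partner, and it
  -- accounts for the `+ 1`.
  · calc ((Finset.range n).filter fun i => t < a i).card
        ≤ (insert 0 (((Finset.range m).filter fun i => t < b i).image Nat.succ)).card := by
          refine Finset.card_le_card fun i hi => ?_
          rw [Finset.mem_filter, Finset.mem_range] at hi
          rcases i with _ | i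
          · simp
          · exact Finset.mem_insert_of_mem (Finset.mem_image_of_mem Nat.succ (Finset.mem_filter.2
              ⟨Finset.mem_range.2 (by omega), hi.2.trans_le (h2 i hi.1)⟩))
      _ ≤ (((Finset.range m).filter fun i => t < b i).image Nat.succ).card + 1 :=
          Finset.card_insert_le _ _
      _ ≤ _ := Nat.add_le_add_right Finset.card_image_le 1

/-! ### Relations between `G_n` at `z` and at `z + 1` -/

/-- The `k`-th term of `G_n(x, z)`, extended by `0` to `k > n / 2`. -/
noncomputable def gegenbauerTerm (n : ℕ) (x z : ℝ) (k : ℕ) : ℝ :=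
  if 2 * k ≤ n then (-1) ^ k / ((k.factorial : ℝ) * ((n - 2 * k).factorial : ℝ)) *
    (∏ i ∈ Finset.range (n - k), (z + i)) * (2 * x) ^ (n - 2 * k) else 0

theorem eval_gegenbauerAt {n N : ℕ} (hN : n / 2 + 1 ≤ N) (x z : ℝ) :
    (gegenbauerAt n x).eval z = ∑ k ∈ Finset.range N, gegenbauerTerm n x z k := by
  rw [← Finset.sum_subset (Finset.range_subset_range.2 hN)]
  · rw [gegenbauerAt, gegenbauer, eval_finsetSum, eval_finsetSum]
    refine Finset.sum_congr rfl fun k hk => ?_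
    rw [gegenbauerTerm, if_pos (by have := Finset.mem_range.1 hk; omega)]
    simp [eval_prod]
  · intro k _ hk
    rw [gegenbauerTerm, if_neg (by have := Finset.mem_range.not.1 hk; omega)]

theorem prod_range_succ_add (z : ℝ) (n : ℕ) :
    ∏ i ∈ Finset.range (n + 1), (z + i) = z * ∏ i ∈ Finset.range n, (z + 1 + i) := by
  rw [Finset.prod_range_succ', mul_comm]
  congr 1
  · simp
  · exact Finset.prod_congr rfl fun i _ => by push_cast; ring

theorem gegenbauerTerm_zero_step (n : ℕ) (x z : ℝ) :
    (n + 2) * gegenbauerTerm (n + 2) x z 0 = 2 * z * (x * gegenbauerTerm (n + 1) x (z + 1) 0) := by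
  simp only [gegenbauerTerm, mul_zero, Nat.zero_le, if_true, Nat.sub_zero, pow_zero,
    Nat.factorial_zero, Nat.cast_one, one_mul]
  rw [prod_range_succ_add z (n + 1), Nat.factorial_succ (n + 1), pow_succ (2 * x) (n + 1)]
  have := Nat.cast_ne_zero (R := ℝ).2 (Nat.factorial_ne_zero (n + 1))
  push_cast
  have h2 : (n : ℝ) + 1 + 1 ≠ 0 := by positivity
  field_simp
  ring

/-- The recurrence holds term by term once the terms of `G_n` are shifted by one index; extension by
zero covers the boundary. -/
theorem gegenbauerTerm_succ_step (n : ℕ) (x z : ℝ) (k : ℕ) :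
    (n + 2) * gegenbauerTerm (n + 2) x z (k + 1) =
      2 * z * (x * gegenbauerTerm (n + 1) x (z + 1) (k + 1) - gegenbauerTerm n x (z + 1) k) := by
  by_cases h : 2 * k ≤ n
  · obtain ⟨r, rfl⟩ := Nat.exists_eq_add_of_le h
    have hk := Nat.cast_ne_zero (R := ℝ).2 (Nat.factorial_ne_zero k)
    have hk1 : (k : ℝ) + 1 ≠ 0 := by positivity
    have e1 : 2 * k + r + 2 - (k + 1) = k + r + 1 := by omega
    have e2 : 2 * k + r + 1 - (k + 1) = k + r := by omega
    have e3 : 2 * k + r - k = k + r := by omega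
    have e4 : 2 * k + r + 2 - 2 * (k + 1) = r := by omega
    have e5 : 2 * k + r - 2 * k = r := by omega
    -- For `r = 0` the term of `G_{n+1}` is absent.
    rcases r with _ | r
    · simp only [gegenbauerTerm]
      rw [if_pos (by omega), if_neg (by omega), if_pos h, e1, e3, e4, e5, prod_range_succ_add,
        Nat.factorial_succ]
      push_cast
      field_simp
      simp
      ring
    · have hr := Nat.cast_ne_zero (R := ℝ).2 (Nat.factorial_ne_zero r)
      have hr1 : (r : ℝ) + 1 ≠ 0 := by positivity
      have e6 : 2 * k + (r + 1) + 1 - 2 * (k + 1) = r := by omega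
      simp only [gegenbauerTerm]
      rw [if_pos (by omega), if_pos (by omega), if_pos h, e1, e2, e3, e4, e5, e6,
        prod_range_succ_add, Nat.factorial_succ, Nat.factorial_succ, pow_succ (2 * x) r]
      push_cast
      field_simp
      ring
  · simp only [gegenbauerTerm]
    rw [if_neg (by omega), if_neg (by omega), if_neg h]
    ring

/-- `n G_n(z) = 2 z (x G_{n-1}(z+1) - G_{n-2}(z+1))`. -/
theorem eval_gegenbauerAt_add_two (n : ℕ) (x z : ℝ) :
    (n + 2) * (gegenbauerAt (n + 2) x).eval z =
      2 * z * (x * (gegenbauerAt (n + 1) x).eval (z + 1) - (gegenbauerAt n x).eval (z + 1)) := by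
  rw [eval_gegenbauerAt (N := n + 1 + 1) (by omega), eval_gegenbauerAt (N := n + 1 + 1) (by omega),
    eval_gegenbauerAt (N := n + 1) (by omega), Finset.sum_range_succ',
    Finset.sum_range_succ' (gegenbauerTerm (n + 1) x (z + 1)), mul_add, gegenbauerTerm_zero_step,
    Finset.mul_sum,
    Finset.sum_congr rfl fun k _ => gegenbauerTerm_succ_step n x z k, ← Finset.mul_sum,
    Finset.sum_sub_distrib, ← Finset.mul_sum]
  ring

theorem gegenbauerTerm_shift (n : ℕ) (x z : ℝ) (k : ℕ) :
    (n + 1 + 2 * z) * gegenbauerTerm (n + 1) x z k =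
      2 * z * (gegenbauerTerm (n + 1) x (z + 1) k - x * gegenbauerTerm n x (z + 1) k) := by
  have hP : ∀ l : ℕ, z * ∏ i ∈ Finset.range l, (z + 1 + i) =
      (∏ i ∈ Finset.range l, (z + i)) * (z + l) := fun l => by
    rw [← prod_range_succ_add, Finset.prod_range_succ]
  by_cases h : 2 * k ≤ n + 1
  · have hk := Nat.cast_ne_zero (R := ℝ).2 (Nat.factorial_ne_zero k)
    obtain ⟨r, hr⟩ := Nat.exists_eq_add_of_le h
    have hn : (n : ℝ) + 1 = 2 * k + r := by exact_mod_cast hr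
    have e1 : n + 1 - k = k + r := by omega
    have e2 : n + 1 - 2 * k = r := by omega
    rcases r with _ | r
    · have h' : ¬ 2 * k ≤ n := by omega
      have := hP k
      simp only [gegenbauerTerm, if_pos h, if_neg h', e1, e2, hn, add_zero, Nat.factorial_zero,
        Nat.cast_zero, Nat.cast_one, mul_one, pow_zero, mul_zero, sub_zero]
      field_simp
      linear_combination -this
    · have hf := Nat.cast_ne_zero (R := ℝ).2 (Nat.factorial_ne_zero r)
      have hr1 : (r : ℝ) + 1 ≠ 0 := by positivity
      have e3 : n - k = k + r := by omega
      have e4 : n - 2 * k = r := by omega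
      have h1 := hP (k + r + 1)
      have h2 := prod_range_succ_add z (k + r)
      have h' : 2 * k ≤ n := by omega
      simp only [gegenbauerTerm, if_pos h, if_pos h', e1, e2, e3, e4, hn, ← add_assoc,
        Nat.factorial_succ, pow_succ (2 * x) r]
      push_cast at h1 ⊢
      field_simp
      linear_combination (-2) * x * (2 * x) ^ r * h1 - (r + 1) * x * (2 * x) ^ r * h2
  · have h' : ¬ 2 * k ≤ n := by omega
    simp only [gegenbauerTerm, if_neg h, if_neg h']
    ring

/-- `(n + 2z) G_n(z) = 2 z (G_n(z+1) - x G_{n-1}(z+1))`. -/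
theorem eval_gegenbauerAt_shift (n : ℕ) (x z : ℝ) :
    (n + 1 + 2 * z) * (gegenbauerAt (n + 1) x).eval z =
      2 * z * ((gegenbauerAt (n + 1) x).eval (z + 1) -
        x * (gegenbauerAt n x).eval (z + 1)) := by
  rw [eval_gegenbauerAt (N := n + 2) (by omega), eval_gegenbauerAt (N := n + 2) (by omega),
    eval_gegenbauerAt (N := n + 2) (by omega), Finset.mul_sum,
    Finset.sum_congr rfl fun k _ => gegenbauerTerm_shift n x z k, ← Finset.mul_sum,
    Finset.sum_sub_distrib, ← Finset.mul_sum]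

theorem gegenbauerAt_zero (x : ℝ) : gegenbauerAt 0 x = 1 := by
  simp [gegenbauerAt, gegenbauer]

theorem gegenbauerAt_one (x : ℝ) : gegenbauerAt 1 x = C (2 * x) * X := by
  refine Polynomial.funext fun z => ?_
  simp [gegenbauerAt, gegenbauer]
  ring

/-- `n x G_n(z) = (n - 1 + 2z) G_{n-1}(z) - 2 (1 - x²) z G_{n-1}(z+1)`. -/
theorem eval_gegenbauerAt_succ (n : ℕ) (x z : ℝ) :
    (n + 1) * x * (gegenbauerAt (n + 1) x).eval z =
      (n + 2 * z) * (gegenbauerAt n x).eval z -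
        2 * (1 - x ^ 2) * z * (gegenbauerAt n x).eval (z + 1) := by
  rcases n with _ | n
  · rw [gegenbauerAt_zero, gegenbauerAt_one]
    simp
    ring
  -- The combination eliminates `G_n(z+1)` from the two preceding relations.
  · have h1 := eval_gegenbauerAt_add_two n x z
    have h2 := eval_gegenbauerAt_shift n x z
    push_cast
    linear_combination x * h1 - h2

/-- `∂_x G_n(x, z) = 2 z G_{n-1}(x, z+1)`. -/
theorem gegenbauerDerivAt_succ (n : ℕ) (x : ℝ) :
    gegenbauerDerivAt (n + 1) x = C 2 * X * (gegenbauerAt n x).comp (X + C 1) := by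
  refine Polynomial.funext fun z => ?_
  have e : (gegenbauerDerivAt (n + 1) x).eval z =
      ∑ k ∈ Finset.range ((n + 1) / 2 + 1), 2 * z * gegenbauerTerm n x (z + 1) k := by
    rw [gegenbauerDerivAt, gegenbauer, derivative_sum, eval_finsetSum, eval_finsetSum]
    refine Finset.sum_congr rfl fun k hk => ?_
    have hk' : 2 * k ≤ n + 1 := by have := Finset.mem_range.1 hk; omega
    obtain ⟨r, hr⟩ := Nat.exists_eq_add_of_le hk'
    have hkf := Nat.cast_ne_zero (R := ℝ).2 (Nat.factorial_ne_zero k)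
    have e1 : n + 1 - k = k + r := by omega
    have e2 : n + 1 - 2 * k = r := by omega
    rw [gegenbauerTerm, e1, e2, derivative_C_mul, derivative_pow]
    rcases r with _ | r
    · rw [if_neg (by omega)]
      simp
    · have hf := Nat.cast_ne_zero (R := ℝ).2 (Nat.factorial_ne_zero r)
      have hr1 : (r : ℝ) + 1 ≠ 0 := by positivity
      have e3 : n - k = k + r := by omega
      have e4 : n - 2 * k = r := by omega
      rw [if_pos (by omega), e3, e4, Nat.factorial_succ]
      have h2 := prod_range_succ_add z (k + r)
      simp [eval_prod]
      rw [← add_assoc, h2]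
      field_simp
  rw [e, ← Finset.mul_sum, ← eval_gegenbauerAt (by omega)]
  simp

theorem gegenbauerAt_neg (n : ℕ) (x : ℝ) :
    gegenbauerAt n (-x) = C ((-1) ^ n) * gegenbauerAt n x := by
  refine Polynomial.funext fun z => ?_
  rw [eval_mul, eval_C, eval_gegenbauerAt le_rfl, eval_gegenbauerAt le_rfl, Finset.mul_sum]
  refine Finset.sum_congr rfl fun k hk => ?_
  have hk' : 2 * k ≤ n := by have := Finset.mem_range.1 hk; omega
  obtain ⟨r, rfl⟩ := Nat.exists_eq_add_of_le hk'
  rw [gegenbauerTerm, gegenbauerTerm, if_pos hk', if_pos hk', Nat.add_sub_cancel_left, mul_neg,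
    neg_pow (2 * x), pow_add, pow_mul]
  simp
  ring

theorem gegenbauerAt_zero_of_odd {n : ℕ} (hn : Odd n) : gegenbauerAt n 0 = 0 := by
  refine Polynomial.funext fun z => ?_
  rw [eval_gegenbauerAt le_rfl, eval_zero]
  refine Finset.sum_eq_zero fun k hk => ?_
  obtain ⟨m, rfl⟩ := hn
  rw [gegenbauerTerm, if_pos (by have := Finset.mem_range.1 hk; omega), mul_zero,
    zero_pow (by have := Finset.mem_range.1 hk; omega), mul_zero]

/-! ### Cofactors of the rising factorials -/

/-- The cofactors of `z (z + 1) ⋯ (z + m - 1)` in `G_{2m}(x, z)` and of `z (z + 1) ⋯ (z + m)` in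
`G_{2m+1}(x, z)`. -/
noncomputable def gegenbauerCofactor (x : ℝ) : ℕ → ℝ[X] × ℝ[X]
  | 0 => (1, C (2 * x))
  | m + 1 =>
    let e := C (1 / ((m : ℝ) + 1)) *
      (C x * ((X + C ((m : ℝ) + 1)) * (gegenbauerCofactor x m).2.comp (X + C 1)) -
        (gegenbauerCofactor x m).1.comp (X + C 1))
    (e, C (2 / (2 * (m : ℝ) + 3)) *
      (C x * e.comp (X + C 1) - (gegenbauerCofactor x m).2.comp (X + C 1)))

/-- The cofactor of `z (z + 1) ⋯ (z + m - 1)` in `G_{2m}(x, z)`. -/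
noncomputable def evenCofactor (x : ℝ) (m : ℕ) : ℝ[X] := (gegenbauerCofactor x m).1

/-- The cofactor of `z (z + 1) ⋯ (z + m)` in `G_{2m+1}(x, z)`. -/
noncomputable def oddCofactor (x : ℝ) (m : ℕ) : ℝ[X] := (gegenbauerCofactor x m).2

theorem evenCofactor_zero (x : ℝ) : evenCofactor x 0 = 1 := rfl

theorem oddCofactor_zero (x : ℝ) : oddCofactor x 0 = C (2 * x) := rfl

theorem evenCofactor_succ (x : ℝ) (m : ℕ) : evenCofactor x (m + 1) = C (1 / ((m : ℝ) + 1)) *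
    (C x * ((X + C ((m : ℝ) + 1)) * (oddCofactor x m).comp (X + C 1)) -
      (evenCofactor x m).comp (X + C 1)) := rfl

theorem oddCofactor_succ (x : ℝ) (m : ℕ) : oddCofactor x (m + 1) = C (2 / (2 * (m : ℝ) + 3)) *
    (C x * (evenCofactor x (m + 1)).comp (X + C 1) - (oddCofactor x m).comp (X + C 1)) := rfl

theorem eval_evenCofactor_succ (x : ℝ) (m : ℕ) (z : ℝ) :
    ((m : ℝ) + 1) * (evenCofactor x (m + 1)).eval z =
      x * ((z + (m + 1)) * (oddCofactor x m).eval (z + 1)) - (evenCofactor x m).eval (z + 1) := by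
  have : (m : ℝ) + 1 ≠ 0 := by positivity
  rw [evenCofactor_succ]
  simp only [eval_mul, eval_C, eval_sub, eval_add, eval_X, eval_comp]
  field_simp

theorem eval_oddCofactor_succ (x : ℝ) (m : ℕ) (z : ℝ) :
    (2 * (m : ℝ) + 3) * (oddCofactor x (m + 1)).eval z =
      2 * (x * (evenCofactor x (m + 1)).eval (z + 1) - (oddCofactor x m).eval (z + 1)) := by
  have : 2 * (m : ℝ) + 3 ≠ 0 := by positivity
  rw [oddCofactor_succ]
  simp only [eval_mul, eval_C, eval_sub, eval_add, eval_X, eval_comp]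
  field_simp

/-- The rising factorial `z (z + 1) ⋯ (z + m - 1)`. -/
noncomputable def risingFactorial (m : ℕ) : ℝ[X] := ∏ i ∈ Finset.range m, (X + C (i : ℝ))

theorem risingFactorial_succ (m : ℕ) :
    risingFactorial (m + 1) = risingFactorial m * (X + C (m : ℝ)) :=
  Finset.prod_range_succ _ _

theorem risingFactorial_ne_zero (m : ℕ) : risingFactorial m ≠ 0 :=
  Finset.prod_ne_zero_iff.2 fun _ _ => X_add_C_ne_zero _

theorem eval_risingFactorial (m : ℕ) (z : ℝ) :
    (risingFactorial m).eval z = ∏ i ∈ Finset.range m, (z + i) := by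
  simp [risingFactorial, eval_prod]

theorem eval_risingFactorial_succ (m : ℕ) (z : ℝ) :
    (risingFactorial (m + 1)).eval z = (risingFactorial m).eval z * (z + m) := by
  simp [risingFactorial_succ]

theorem eval_risingFactorial_succ' (m : ℕ) (z : ℝ) :
    (risingFactorial (m + 1)).eval z = z * (risingFactorial m).eval (z + 1) := by
  rw [eval_risingFactorial, eval_risingFactorial, prod_range_succ_add]

theorem X_mul_risingFactorial_comp (m : ℕ) :
    X * (risingFactorial m).comp (X + C 1) = risingFactorial (m + 1) :=
  Polynomial.funext fun z => by simp [eval_risingFactorial_succ']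

/-- The factor `z` in the recurrence turns a shifted `(z+1)_m` into `(z)_{m+1}`. In the even step
the two shifted rising factorials differ in length, which leaves the extra factor `z + m + 1`. -/
theorem gegenbauerAt_factor (x : ℝ) (m : ℕ) :
    gegenbauerAt (2 * m) x = risingFactorial m * evenCofactor x m ∧
      gegenbauerAt (2 * m + 1) x = risingFactorial (m + 1) * oddCofactor x m := by
  induction m with
  | zero =>
    rw [mul_zero, zero_add, gegenbauerAt_zero, gegenbauerAt_one, evenCofactor_zero,
      oddCofactor_zero]
    simp [risingFactorial, mul_comm]
  | succ m ih =>
    obtain ⟨h0, h1⟩ := ih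
    have h2 : gegenbauerAt (2 * (m + 1)) x = risingFactorial (m + 1) * evenCofactor x (m + 1) := by
      refine Polynomial.funext fun z => ?_
      have h := eval_gegenbauerAt_add_two (2 * m) x z
      have he := eval_evenCofactor_succ x m z
      have hm : 2 * ((m : ℝ) + 1) ≠ 0 := by positivity
      rw [h0, h1, eval_mul, eval_mul, eval_risingFactorial_succ] at h
      rw [mul_add, mul_one, eval_mul, eval_risingFactorial_succ']
      refine mul_left_cancel₀ hm ?_
      push_cast at h
      linear_combination h - 2 * z * (risingFactorial m).eval (z + 1) * he
    refine ⟨h2, Polynomial.funext fun z => ?_⟩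
    have h := eval_gegenbauerAt_add_two (2 * m + 1) x z
    have ho := eval_oddCofactor_succ x m z
    have hm : 2 * (m : ℝ) + 3 ≠ 0 := by positivity
    rw [show 2 * m + 1 + 1 = 2 * (m + 1) by ring, h1, h2, eval_mul, eval_mul] at h
    rw [show 2 * (m + 1) + 1 = 2 * m + 1 + 2 by ring, eval_mul, eval_risingFactorial_succ']
    refine mul_left_cancel₀ hm ?_
    push_cast at h
    linear_combination h - z * (risingFactorial (m + 1)).eval (z + 1) * ho

/-- For `x² < 1` this forces `e_m` to have the same sign at `z` and `z + 1` whenever `o_m(z) = 0`.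
-/
theorem evenCofactor_relation (x : ℝ) (m : ℕ) (z : ℝ) :
    2 * (evenCofactor x m).eval z - (2 * m + 1) * x * (oddCofactor x m).eval z =
      2 * (1 - x ^ 2) * (evenCofactor x m).eval (z + 1) := by
  have key : C 2 * evenCofactor x m - C ((2 * m + 1) * x) * oddCofactor x m =
      C (2 * (1 - x ^ 2)) * (evenCofactor x m).comp (X + C 1) := by
    -- The rising factorial is cancelled between polynomials, since its value at a given `z` may be
    -- zero.
    refine mul_left_cancel₀ (risingFactorial_ne_zero (m + 1)) (Polynomial.funext fun z => ?_)
    have h := eval_gegenbauerAt_succ (2 * m) x z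
    have h1 := eval_risingFactorial_succ m z
    have h2 := eval_risingFactorial_succ' m z
    rw [(gegenbauerAt_factor x m).1, (gegenbauerAt_factor x m).2] at h
    simp only [eval_mul, eval_sub, eval_C, eval_comp, eval_add, eval_X] at h ⊢
    push_cast at h
    linear_combination 2 * (evenCofactor x m).eval z * h1 - h -
      2 * (1 - x ^ 2) * (evenCofactor x m).eval (z + 1) * h2
  simpa using congrArg (eval z) key

/-- Both coefficients of `o_m` are positive for `z > -m - 1/2`, whence the lower bound on roots
carried through the induction. -/
theorem oddCofactor_relation (x : ℝ) (m : ℕ) (z : ℝ) :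
    (2 * m + 1 + 2 * z) * (oddCofactor x m).eval z -
        (2 * m + 2) * x * (evenCofactor x (m + 1)).eval z =
      2 * (1 - x ^ 2) * (z + m + 1) * (oddCofactor x m).eval (z + 1) := by
  have key : (C (2 * (m : ℝ) + 1) + C 2 * X) * oddCofactor x m -
        C ((2 * m + 2) * x) * evenCofactor x (m + 1) =
      C (2 * (1 - x ^ 2)) * (X + C ((m : ℝ) + 1)) * (oddCofactor x m).comp (X + C 1) := by
    refine mul_left_cancel₀ (risingFactorial_ne_zero (m + 1)) (Polynomial.funext fun z => ?_)
    have h := eval_gegenbauerAt_succ (2 * m + 1) x z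
    have h1 := eval_risingFactorial_succ (m + 1) z
    have h2 := eval_risingFactorial_succ' (m + 1) z
    rw [show 2 * m + 1 + 1 = 2 * (m + 1) by ring, (gegenbauerAt_factor x m).2,
      (gegenbauerAt_factor x (m + 1)).1] at h
    simp only [eval_mul, eval_sub, eval_C, eval_comp, eval_add, eval_X] at h ⊢
    push_cast at h h1
    linear_combination -h + 2 * (1 - x ^ 2) * (oddCofactor x m).eval (z + 1) * (h1 - h2)
  have := congrArg (eval z) key
  simp only [eval_mul, eval_sub, eval_C, eval_comp, eval_add, eval_X] at this
  linear_combination this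

theorem natDegree_leadingCoeff_sub {p q : ℝ[X]} {d : ℕ} {c : ℝ} (hc : 0 < c)
    (hp : p.natDegree = d + 1) (hpl : 0 < p.leadingCoeff) (hq : q.natDegree ≤ d) :
    (C c * (p - q)).natDegree = d + 1 ∧ 0 < (C c * (p - q)).leadingCoeff := by
  have hlt : q.natDegree < p.natDegree := by omega
  have h1 : (p - q).natDegree = d + 1 := by rw [natDegree_sub_eq_left_of_natDegree_lt hlt, hp]
  have h2 : (p - q).leadingCoeff = p.leadingCoeff := by
    rw [leadingCoeff, leadingCoeff, h1, hp, coeff_sub,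
      coeff_eq_zero_of_natDegree_lt (p := q) (by omega), sub_zero]
  rw [natDegree_C_mul hc.ne', leadingCoeff_mul, leadingCoeff_C, h1, h2]
  exact ⟨rfl, by positivity⟩

theorem natDegree_leadingCoeff_comp (p : ℝ[X]) :
    (p.comp (X + C 1)).natDegree = p.natDegree ∧
      (p.comp (X + C 1)).leadingCoeff = p.leadingCoeff := by
  constructor
  · rw [natDegree_comp, natDegree_X_add_C, mul_one]
  · rw [leadingCoeff_comp (by rw [natDegree_X_add_C]; exact one_ne_zero), leadingCoeff_X_add_C,
      one_pow, mul_one]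

theorem cofactor_degree {x : ℝ} (hx : 0 < x) (m : ℕ) :
    ((evenCofactor x m).natDegree = m ∧ 0 < (evenCofactor x m).leadingCoeff) ∧
      (oddCofactor x m).natDegree = m ∧ 0 < (oddCofactor x m).leadingCoeff := by
  induction m with
  | zero =>
    rw [evenCofactor_zero, oddCofactor_zero, natDegree_one, leadingCoeff_one, natDegree_C,
      leadingCoeff_C]
    exact ⟨⟨rfl, one_pos⟩, rfl, by positivity⟩
  | succ m ih =>
    obtain ⟨⟨he, hel⟩, ho, hol⟩ := ih
    obtain ⟨he1, he2⟩ := natDegree_leadingCoeff_comp (evenCofactor x m)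
    obtain ⟨ho1, ho2⟩ := natDegree_leadingCoeff_comp (oddCofactor x m)
    have h1 : (evenCofactor x (m + 1)).natDegree = m + 1 ∧
        0 < (evenCofactor x (m + 1)).leadingCoeff := by
      rw [evenCofactor_succ]
      refine natDegree_leadingCoeff_sub (by positivity) ?_ ?_ (by omega)
      · rw [natDegree_C_mul hx.ne', natDegree_mul (X_add_C_ne_zero _), natDegree_X_add_C, ho1, ho,
          add_comm]
        rw [← leadingCoeff_ne_zero, ho2]
        exact hol.ne'
      · rw [leadingCoeff_mul, leadingCoeff_mul, leadingCoeff_C, leadingCoeff_X_add_C, ho2]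
        positivity
    obtain ⟨hf1, hf2⟩ := natDegree_leadingCoeff_comp (evenCofactor x (m + 1))
    refine ⟨h1, ?_⟩
    rw [oddCofactor_succ]
    refine natDegree_leadingCoeff_sub (by positivity) ?_ ?_ (by omega)
    · rw [natDegree_C_mul hx.ne', hf1, h1.1]
    · rw [leadingCoeff_mul, leadingCoeff_C, hf2]
      exact mul_pos hx h1.2

/-! ### Induction on the position of the roots -/

/-- Roots of the cofactors of `G_{2m}` and `G_{2m+1}`: gaps exceed `1`, and they alternate. -/
def EvenOddRoots (x : ℝ) (m : ℕ) (a b : ℕ → ℝ) : Prop :=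
  IsRootSeq (evenCofactor x m) m a ∧ IsRootSeq (oddCofactor x m) m b ∧
    (∀ i < m, 1 / 2 - (m : ℝ) < a i) ∧ (∀ i < m, a i < b i) ∧
      ∀ i, i + 1 < m → b (i + 1) < a i - 1

/-- Roots of the cofactors of `G_{2m+1}` and `G_{2m+2}`: gaps exceed `1`, and they alternate. -/
def OddEvenRoots (x : ℝ) (m : ℕ) (b a : ℕ → ℝ) : Prop :=
  IsRootSeq (oddCofactor x m) m b ∧ IsRootSeq (evenCofactor x (m + 1)) (m + 1) a ∧
    (∀ i < m + 1, 1 / 2 - ((m : ℝ) + 1) < a i) ∧ (∀ i < m, b i < a i) ∧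
      ∀ i < m, a (i + 1) < b i - 1

theorem isRootSeq_zero {p : ℝ[X]} (h : p.natDegree = 0) (hl : 0 < p.leadingCoeff) (a : ℕ → ℝ) :
    IsRootSeq p 0 a := by
  refine ⟨fun i j _ hj => absurd hj (Nat.not_lt_zero j), p.leadingCoeff, hl, ?_⟩
  rw [leadingCoeff, h, Finset.range_zero, Finset.prod_empty, mul_one]
  exact eq_C_of_natDegree_eq_zero h

theorem evenOddRoots_zero {x : ℝ} (hx : 0 < x) : EvenOddRoots x 0 0 0 := by
  obtain ⟨⟨h1, h2⟩, h3, h4⟩ := cofactor_degree hx 0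
  exact ⟨isRootSeq_zero h1 h2 _, isRootSeq_zero h3 h4 _, by simp, by simp, by simp⟩

theorem IsRootSeq.antitone {p : ℝ[X]} {d : ℕ} {a : ℕ → ℝ} (h : IsRootSeq p d a) {i j : ℕ}
    (hij : i ≤ j) (hj : j < d) : a j ≤ a i := by
  rcases hij.eq_or_lt with rfl | hlt
  · exact le_rfl
  · exact (h.1 i j hlt hj).le

/-- The points `b i - 1` number only `m`, one too few for degree `m + 1`; the missing lowest
separator is `-m - 1/2`, where the coefficient `2m + 1 + 2z` of `oddCofactor_relation` vanishes. -/
theorem EvenOddRoots.exists_next {x : ℝ} (hx : 0 < x) (hx1 : x < 1) {m : ℕ} {a b : ℕ → ℝ}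
    (h : EvenOddRoots x m a b) : ∃ a', OddEvenRoots x m b a' := by
  obtain ⟨ha, hb, hbd, hab, hba⟩ := h
  obtain ⟨⟨hd, hl⟩, -⟩ := cofactor_degree hx (m + 1)
  have hw : 0 < 1 - x ^ 2 := by nlinarith
  have hm1 : (0 : ℝ) < m + 1 := by positivity
  have hgap : ∀ i, i + 1 < m → b (i + 1) < b i - 1 := fun i hi => by
    linarith [hba i hi, hab i (by omega)]
  have hbot : ∀ i < m, 1 / 2 - (m : ℝ) < b i := fun i hi => (hbd i hi).trans (hab i hi)
  obtain ⟨a', ha', hlo, hup⟩ := exists_isRootSeq_of_sign_top (f := evenCofactor x (m + 1))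
    (s := fun i => if i < m then b i - 1 else 1 / 2 - ((m : ℝ) + 1)) hd hl
    (by
      intro i hi
      rw [if_pos (show i < m by omega)]
      split_ifs with h1
      · linarith [hgap i h1]
      · linarith [hbot i (by omega)])
    (by
      intro i hi
      split_ifs with h1
      · have hs : 0 < (-1) ^ i * (evenCofactor x m).eval (b i) := by
          refine ha.sign h1.le (fun j hj => ?_) fun j hj hjd => ?_
          · linarith [hba (i - 1) (by omega), ha.antitone (show j ≤ i - 1 by omega) (by omega),
              show b (i - 1 + 1) = b i by rw [Nat.sub_add_cancel (by omega)]]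
          · exact (ha.antitone hj hjd).trans_lt (hab i h1)
        -- At `b i - 1` the term with `o_m` drops out, leaving minus `e_m(b i)`.
        have hr := eval_evenCofactor_succ x m (b i - 1)
        rw [sub_add_cancel, hb.eval_eq_zero h1] at hr
        refine pos_of_mul_pos_right (a := (m : ℝ) + 1) ?_ hm1.le
        rw [pow_succ]
        linear_combination hs + (-1) ^ i * hr
      · have him : i = m := by omega
        subst him
        have hs : 0 < (-1) ^ i * (oddCofactor x i).eval (1 / 2 - ((i : ℝ) + 1) + 1) :=
          hb.sign le_rfl (fun j hj => by linarith [hbot j hj]) fun j hj hjd => by omega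
        -- Only `o_m(z + 1)` remains on one side, taken at `1/2 - m`, below all roots of `o_m`.
        have hr := oddCofactor_relation x i (1 / 2 - ((i : ℝ) + 1))
        have hq : 0 < (2 * (i : ℝ) + 2) * x := by positivity
        refine pos_of_mul_pos_right (a := (2 * (i : ℝ) + 2) * x) ?_ hq.le
        have e : (2 * (i : ℝ) + 2) * x * ((-1) ^ (i + 1) *
            (evenCofactor x (i + 1)).eval (1 / 2 - ((i : ℝ) + 1))) =
            (1 - x ^ 2) * ((-1) ^ i * (oddCofactor x i).eval (1 / 2 - ((i : ℝ) + 1) + 1)) := by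
          rw [pow_succ]
          linear_combination (-1) ^ i * hr
        rw [e]
        positivity)
  have hbd' : ∀ i < m + 1, 1 / 2 - ((m : ℝ) + 1) < a' i := by
    intro i hi
    have h1 := hlo m (by omega)
    rw [if_neg (lt_irrefl m)] at h1
    exact h1.trans_le (ha'.antitone (by omega) (by omega))
  have hup' : ∀ i < m, a' (i + 1) < b i - 1 := fun i hi => by
    simpa [hi] using hup i (by omega)
  refine ⟨a', hb, ha', hbd', fun i hi => ?_, hup'⟩
  refine hb.lt_of_shift hgap hi (by simpa [hi] using hlo i (by omega)) ?_ ?_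
  · rintro j rfl
    exact hup' j (by omega)
  · have h1 := hbd' i (by omega)
    have hr := oddCofactor_relation x m (a' i)
    rw [ha'.eval_eq_zero (by omega), mul_zero, sub_zero] at hr
    refine ⟨2 * m + 1 + 2 * a' i, 2 * (1 - x ^ 2) * (a' i + m + 1), by linarith, ?_, hr⟩
    have : 0 < a' i + m + 1 := by linarith
    positivity

/-- The degree does not grow here, so the shifted roots `a i - 1` suffice as separators; the
coefficients in `evenCofactor_relation` are positive constants, so no lower bound on the new roots
is needed. -/
theorem OddEvenRoots.exists_next {x : ℝ} (hx : 0 < x) (hx1 : x < 1) {m : ℕ} {a b : ℕ → ℝ}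
    (h : OddEvenRoots x m b a) : ∃ b', EvenOddRoots x (m + 1) a b' := by
  obtain ⟨hb, ha, hbd, hba, hab⟩ := h
  obtain ⟨-, hd, hl⟩ := cofactor_degree hx (m + 1)
  have hw : 0 < 1 - x ^ 2 := by nlinarith
  have hm1 : (0 : ℝ) < 2 * m + 3 := by positivity
  have hgap : ∀ i, i + 1 < m + 1 → a (i + 1) < a i - 1 := fun i hi => by
    linarith [hab i (by omega), hba i (by omega)]
  obtain ⟨b', hb', hlo, hup⟩ := exists_isRootSeq_of_sign_top (f := oddCofactor x (m + 1))
    (s := fun i => a i - 1) hd hl (fun i hi => by linarith [hgap i hi])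
    (by
      intro i hi
      have hs : 0 < (-1) ^ i * (oddCofactor x m).eval (a i) := by
        refine hb.sign (by omega) (fun j hj => ?_) fun j hj hjd => ?_
        · linarith [hab (i - 1) (by omega), hb.antitone (show j ≤ i - 1 by omega) (by omega),
            show a (i - 1 + 1) = a i by rw [Nat.sub_add_cancel (by omega)]]
        · exact (hb.antitone hj hjd).trans_lt (hba i (by omega))
      have hr := eval_oddCofactor_succ x m (a i - 1)
      rw [sub_add_cancel, ha.eval_eq_zero hi] at hr
      refine pos_of_mul_pos_right (a := 2 * (m : ℝ) + 3) ?_ hm1.le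
      rw [pow_succ]
      linear_combination 2 * hs + (-1) ^ i * hr)
  refine ⟨b', ha, hb', by exact_mod_cast hbd, fun i hi => ?_, hup⟩
  refine ha.lt_of_shift hgap hi (hlo i hi) ?_ ?_
  · rintro j rfl
    exact hup j hi
  · have hr := evenCofactor_relation x (m + 1) (b' i)
    rw [hb'.eval_eq_zero hi, mul_zero, sub_zero] at hr
    exact ⟨2, 2 * (1 - x ^ 2), two_pos, by positivity, hr⟩

theorem exists_evenOddRoots {x : ℝ} (hx : 0 < x) (hx1 : x < 1) (m : ℕ) :
    ∃ a b, EvenOddRoots x m a b := by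
  induction m with
  | zero => exact ⟨0, 0, evenOddRoots_zero hx⟩
  | succ m ih =>
    obtain ⟨a, b, h⟩ := ih
    obtain ⟨a', h'⟩ := h.exists_next hx hx1
    exact ⟨a', h'.exists_next hx hx1⟩

/-! ### Interlacing for `0 < x < 1` -/

theorem hasRootMultiset_prod (d : ℕ) (a : ℕ → ℝ) {c : ℝ} (hc : c ≠ 0) :
    HasRootMultiset (C c * ∏ i ∈ Finset.range d, (X - C (a i))) ((Multiset.range d).map a) :=
  ⟨c, hc, by rw [Multiset.map_map]; rfl⟩

/-- The roots of `z (z + 1) ⋯ (z + m - 1)`. -/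
noncomputable def risingRoots (m : ℕ) : Multiset ℝ := (Multiset.range m).map fun i : ℕ => -(i : ℝ)

theorem risingRoots_succ (m : ℕ) : risingRoots (m + 1) = risingRoots m + {-(m : ℝ)} := by
  rw [risingRoots, Multiset.range_succ, Multiset.map_cons, add_comm]
  rfl

theorem hasRootMultiset_risingFactorial (m : ℕ) :
    HasRootMultiset (risingFactorial m) (risingRoots m) := by
  have := hasRootMultiset_prod m (fun i => -(i : ℝ)) one_ne_zero
  simpa [risingFactorial, risingRoots] using this

theorem singleton_add_map_range (m : ℕ) (b : ℕ → ℝ) (r : ℝ) :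
    {r} + (Multiset.range m).map b =
      (Multiset.range (m + 1)).map fun i => if i < m then b i else r := by
  rw [Multiset.range_succ, Multiset.map_cons, if_neg (lt_irrefl m), Multiset.singleton_add]
  congr 1
  exact Multiset.map_congr rfl fun i hi => (if_pos (Multiset.mem_range.1 hi)).symm

/-- Shifting `G` by `z ↦ z + 1` and multiplying by `2 z`. -/
theorem HasRootMultiset.two_mul_X_comp {q : ℝ[X]} {m : ℕ} {B : Multiset ℝ}
    (hq : HasRootMultiset (q.comp (X + C 1)) B) :
    HasRootMultiset (C 2 * X * (risingFactorial m * q).comp (X + C 1))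
      (risingRoots (m + 1) + B) := by
  rw [mul_comp, mul_assoc, ← mul_assoc X, X_mul_risingFactorial_comp]
  exact ((hasRootMultiset_risingFactorial (m + 1)).mul hq).C_mul two_ne_zero

theorem interlaces_of_lt_one {x : ℝ} (hx : 0 < x) (hx1 : x < 1) (n : ℕ) :
    Interlaces (gegenbauerAt (n + 1) x) (gegenbauerAt n x) ∧
      Interlaces (gegenbauerAt (n + 1) x) (gegenbauerDerivAt (n + 1) x) := by
  rw [gegenbauerDerivAt_succ]
  obtain ⟨m, rfl | rfl⟩ := Nat.even_or_odd' n
  · obtain ⟨a, b, ha, hb, hbd, hab, hba⟩ := exists_evenOddRoots hx hx1 m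
    rw [(gegenbauerAt_factor x m).1, (gegenbauerAt_factor x m).2]
    have hB := (hasRootMultiset_risingFactorial (m + 1)).mul hb.hasRootMultiset
    constructor
    · refine interlaces_of_countLeads hB
        ((hasRootMultiset_risingFactorial m).mul ha.hasRootMultiset)
        (Or.inr (by simp [risingRoots])) ?_
      -- The extra root `-m` of `G_{2m+1}` lies below every `a i > 1/2 - m`, so it ends the chain.
      rw [risingRoots_succ, add_assoc, singleton_add_map_range]
      refine (countLeads_of_chain (by omega) le_rfl (fun i hi => ?_) fun i hi => ?_).add_left _
      · rw [if_pos hi]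
        exact (hab i hi).le
      · split_ifs with h1
        · linarith [hba i h1]
        · linarith [hbd i (by omega)]
    · refine interlaces_of_countLeads hB
        (ha.comp_X_add_one.hasRootMultiset.two_mul_X_comp) (Or.inl (by simp)) ?_
      refine (countLeads_of_chain le_rfl (by omega) (fun i hi => ?_) fun i hi => ?_).add_left _
      · linarith [hab i hi]
      · exact (hba i hi).le
  · obtain ⟨a, b, h⟩ := exists_evenOddRoots hx hx1 m
    obtain ⟨a', hb, ha, hbd, hba, hab⟩ := h.exists_next hx hx1
    rw [show 2 * m + 1 + 1 = 2 * (m + 1) by ring, (gegenbauerAt_factor x (m + 1)).1,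
      (gegenbauerAt_factor x m).2]
    have hA := (hasRootMultiset_risingFactorial (m + 1)).mul ha.hasRootMultiset
    constructor
    · refine interlaces_of_countLeads hA
        ((hasRootMultiset_risingFactorial (m + 1)).mul hb.hasRootMultiset)
        (Or.inr (by simp)) ?_
      refine (countLeads_of_chain (by omega) le_rfl (fun i hi => ?_) fun i hi => ?_).add_left _
      · exact (hba i hi).le
      · linarith [hab i (by omega)]
    · refine interlaces_of_countLeads hA
        (hb.comp_X_add_one.hasRootMultiset.two_mul_X_comp)
        (Or.inl (by simp [risingRoots])) ?_
      -- The extra root `-(m + 1)` of the derivative lies below every root of `e_{m+1}`.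
      rw [risingRoots_succ (m + 1), add_assoc, singleton_add_map_range]
      refine (countLeads_of_chain le_rfl (by omega) (fun i hi => ?_) fun i hi => ?_).add_left _
      · split_ifs with h1
        · linarith [hba i h1]
        · have := hbd i hi
          push_cast
          linarith
      · rw [if_pos (by omega)]
        exact (hab i (by omega)).le

/-! ### The endpoint `x = 1` -/

/-- The term with `1 - x²` disappears from `eval_gegenbauerAt_succ`, leaving `(n + 1) G_{n+1} = (n +
2z) G_n`. The cofactor roots are then spaced by exactly `1`, so the strict induction does not apply.
-/
theorem exists_gegenbauerAt_at_one (n : ℕ) :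
    ∃ c : ℝ, c ≠ 0 ∧
      gegenbauerAt n 1 = C c * ∏ i ∈ Finset.range n, (X - C (-(i : ℝ) / 2)) := by
  induction n with
  | zero => exact ⟨1, one_ne_zero, by simp [gegenbauerAt_zero]⟩
  | succ n ih =>
    obtain ⟨c, hc, h⟩ := ih
    have hn : (n : ℝ) + 1 ≠ 0 := by positivity
    refine ⟨c * (2 / (n + 1)), by positivity, Polynomial.funext fun z => ?_⟩
    have h1 := eval_gegenbauerAt_succ n 1 z
    rw [h] at h1
    rw [Finset.prod_range_succ]
    simp only [eval_mul, eval_C, eval_sub, eval_X] at h1 ⊢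
    refine mul_left_cancel₀ hn ?_
    generalize ∏ i ∈ Finset.range n, (X - C (-(i : ℝ) / 2)) = Q at h1 ⊢
    field_simp
    linear_combination h1

theorem interlaces_at_one (n : ℕ) :
    Interlaces (gegenbauerAt (n + 1) 1) (gegenbauerAt n 1) ∧
      Interlaces (gegenbauerAt (n + 1) 1) (gegenbauerDerivAt (n + 1) 1) := by
  obtain ⟨c, hc, h⟩ := exists_gegenbauerAt_at_one n
  obtain ⟨d, hd, h'⟩ := exists_gegenbauerAt_at_one (n + 1)
  -- Index `0` is the root of the factor `2z`; the others are the roots of `G_n` moved left by `1`.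
  have hD : gegenbauerDerivAt (n + 1) 1 = C (2 * c) * ∏ i ∈ Finset.range (n + 1),
      (X - C (if i = 0 then 0 else -((i : ℝ) + 1) / 2)) := by
    rw [gegenbauerDerivAt_succ, h, Finset.prod_range_succ']
    refine Polynomial.funext fun z => ?_
    have e : ∏ i ∈ Finset.range n, (z + 1 + (i : ℝ) / 2) =
        ∏ i ∈ Finset.range n, (z - (-1 + (-1 + -(i : ℝ))) / 2) :=
      Finset.prod_congr rfl fun i _ => by ring
    simp [eval_prod, prod_comp, neg_div]
    rw [e]
    ring
  rw [hD, h, h']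
  constructor
  · refine interlaces_of_countLeads (hasRootMultiset_prod _ _ hd) (hasRootMultiset_prod _ _ hc)
      (Or.inr (by simp)) (countLeads_of_chain (by omega) le_rfl (fun i _ => le_rfl) fun i _ => ?_)
    push_cast
    linarith
  · refine interlaces_of_countLeads (hasRootMultiset_prod _ _ hd)
      (hasRootMultiset_prod _ _ (by positivity)) (Or.inl (by simp))
      (countLeads_of_chain le_rfl (by omega) (fun i _ => ?_) fun i _ => ?_)
    · split_ifs with h0
      · simp [h0]
      · linarith
    · have : (0 : ℝ) ≤ i := i.cast_nonneg
      push_cast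
      split_ifs <;> linarith

/-! ### Negative `x` and `x = 0` -/

theorem HasOrderedRealRoots.const_mul {p : ℝ[X]} {n : ℕ} {a : Fin n → ℝ}
    (h : HasOrderedRealRoots p n a) {c : ℝ} (hc : c ≠ 0) : HasOrderedRealRoots (C c * p) n a := by
  obtain ⟨h1, h2, h3, h4⟩ := h
  exact ⟨mul_ne_zero (C_ne_zero.2 hc) h1, by rw [natDegree_C_mul hc, h2], h3,
    by rw [roots_C_mul _ hc, h4]⟩

theorem Interlaces.const_mul {p q : ℝ[X]} (h : Interlaces p q) {c d : ℝ} (hc : c ≠ 0)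
    (hd : d ≠ 0) : Interlaces (C c * p) (C d * q) := by
  obtain ⟨n, m, a, b, ha, hb, h⟩ := h
  exact ⟨n, m, a, b, ha.const_mul hc, hb.const_mul hd, h⟩

theorem gegenbauerDerivAt_neg (n : ℕ) (x : ℝ) :
    gegenbauerDerivAt (n + 1) (-x) = C ((-1) ^ n) * gegenbauerDerivAt (n + 1) x := by
  rw [gegenbauerDerivAt_succ, gegenbauerDerivAt_succ, gegenbauerAt_neg, mul_comp, C_comp]
  ring

theorem interlaces_of_pos {x : ℝ} (hx : 0 < x) (hx1 : x ≤ 1) (n : ℕ) :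
    Interlaces (gegenbauerAt (n + 1) x) (gegenbauerAt n x) ∧
      Interlaces (gegenbauerAt (n + 1) x) (gegenbauerDerivAt (n + 1) x) := by
  rcases hx1.eq_or_lt with rfl | hlt
  · exact interlaces_at_one n
  · exact interlaces_of_lt_one hx hlt n

theorem mainTheorem3 (n : ℕ) (hn : 1 ≤ n) :
    (∀ x : ℝ, x ∈ Set.Ico (-1 : ℝ) 0 ∪ Set.Ioc (0 : ℝ) 1 →
      Interlaces (gegenbauerAt n x) (gegenbauerAt (n - 1) x) ∧
        Interlaces (gegenbauerAt n x) (gegenbauerDerivAt n x)) ∧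
    (gegenbauerAt n 0 = 0 ∨ gegenbauerAt (n - 1) 0 = 0) ∧
    (gegenbauerAt n 0 = 0 ∨ gegenbauerDerivAt n 0 = 0) := by
  obtain ⟨n, rfl⟩ := Nat.exists_eq_add_of_le' hn
  rw [Nat.add_sub_cancel]
  refine ⟨?_, ?_⟩
  · rintro x (⟨h1, h2⟩ | ⟨h1, h2⟩)
    · obtain ⟨y, rfl⟩ : ∃ y, x = -y := ⟨-x, (neg_neg x).symm⟩
      obtain ⟨h3, h4⟩ := interlaces_of_pos (x := y) (by linarith) (by linarith) n
      rw [gegenbauerAt_neg, gegenbauerAt_neg, gegenbauerDerivAt_neg]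
      have hs : ∀ k : ℕ, (-1 : ℝ) ^ k ≠ 0 := fun k => pow_ne_zero k (by norm_num)
      exact ⟨h3.const_mul (hs _) (hs _), h4.const_mul (hs _) (hs _)⟩
    · exact interlaces_of_pos h1 h2 n
  -- One of two consecutive indices is odd; if it is the lower one, the derivative vanishes too,
  -- being `2 z G_n(0, z+1)`.
  · rcases Nat.even_or_odd n with he | ho
    · have := gegenbauerAt_zero_of_odd he.add_one
      exact ⟨Or.inl this, Or.inl this⟩
    · have := gegenbauerAt_zero_of_odd ho
      exact ⟨Or.inr this, Or.inr (by rw [gegenbauerDerivAt_succ, this, zero_comp, mul_zero])⟩
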